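/- Let $p$ be a prime. For an integer $u \ge 0$, let $\nu^u_{\mathrm{CL}}$ be the Cohen–Lenstra measure of unit-rank $u$, that is, the probability measure on the set of isomorphism classes of finite abelian $p$-groups that gives the class of $A$ the mass $$\nu^u_{\mathrm{CL}}(A) = \frac{1}{Z_u}\cdot\frac{1}{(\#A)^u\,\#\mathrm{Aut}(A)}, \qquad Z_u = \sum_{B} \frac{1}{(\#B)^u\,\#\mathrm{Aut}(B)},$$ where the sum runs over all isomorphism classes of finite abelian $p$-groups (it is finite, so that $\nu^u_{\mathrm{CL}}$ is indeed a probability measure). Let $$\mathbf{H}(\nu^u_{\mathrm{CL}}) = -\sum_{A} \nu^u_{\mathrm{CL}}(A)\,\log \nu^u_{\mathrm{CL}}(A) \in [0,\infty]$$ be its Shannon entropy. Then: (I) $\mathbf{H}(\nu^u_{\mathrm{CL}}) < \infty$ for every integer $u \ge 0$; (II) $\mathbf{H}(\nu^u_{\mathrm{CL}})$ is a strictly decreasing function of the integer $u \ge 0$; (III) $\mathbf{H}(\nu^u_{\mathrm{CL}}) \to 0$ as $u \to \infty$. In particular, $\mathbf{H}(\nu^u_{\mathrm{CL}}) < \mathbf{H}(\nu^0_{\mathrm{CL}})$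 for all $u \ge 1$: the groupoid measure $\nu^0_{\mathrm{CL}}$, for which the mass of $A$ is proportional to $1/\#\mathrm{Aut}(A)$, has the largest entropy in this family. -/

import Mathlib

open MeasureTheory Filter Topology
open scoped ENNReal

noncomputable section

namespace CohenLenstra

/-- A finite abelian `p`-group, written additively. Every finite abelian `p`-group, in any universe,
is isomorphic to one of these. -/
structure FinAbPGroup (p : ℕ) : Type 1 where
  carrier : Type
  [addCommGroup : AddCommGroup carrier]
  [finite : Finite carrier]
  isPGroup : IsPGroup p (Multiplicative carrier)

attribute [instance] FinAbPGroup.addCommGroup FinAbPGroup.finite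

/-- Isomorphism of finite abelian `p`-groups. -/
instance isoSetoid (p : ℕ) : Setoid (FinAbPGroup p) where
  r A B := Nonempty (A.carrier ≃+ B.carrier)
  iseqv :=
    ⟨fun A => ⟨AddEquiv.refl A.carrier⟩, fun ⟨e⟩ => ⟨e.symm⟩, fun ⟨e⟩ ⟨f⟩ => ⟨e.trans f⟩⟩

/-- The isomorphism classes of finite abelian `p`-groups. -/
def IsoClass (p : ℕ) : Type 1 := Quotient (isoSetoid p)

/-- The isomorphism classes form a discrete space: all subsets are measurable. -/
instance (p : ℕ) : MeasurableSpace (IsoClass p) := ⊤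

/-- The isomorphism class of a finite abelian `p`-group. -/
def IsoClass.mk {p : ℕ} (A : FinAbPGroup p) : IsoClass p := Quotient.mk (isoSetoid p) A

/-- The weight `1 / (#A ^ u * #Aut A)` of a finite abelian `p`-group `A`. -/
def groupWeight {p : ℕ} (u : ℕ) (A : FinAbPGroup p) : ℝ≥0∞ :=
  ((Nat.card A.carrier : ℝ≥0∞) ^ u * (Nat.card (AddAut A.carrier) : ℝ≥0∞))⁻¹

theorem groupWeight_congr {p : ℕ} (u : ℕ) (A B : FinAbPGroup p)
    (h : Nonempty (A.carrier ≃+ B.carrier)) : groupWeight u A = groupWeight u B := by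
  obtain ⟨e⟩ := h
  have h1 : Nat.card A.carrier = Nat.card B.carrier := Nat.card_congr e.toEquiv
  have h2 : Nat.card (AddAut A.carrier) = Nat.card (AddAut B.carrier) :=
    Nat.card_congr (AddAut.congr e).toEquiv
  simp only [groupWeight, h1, h2]

/-- The weight `1 / (#A ^ u * #Aut A)` as a function of the isomorphism class of `A`. -/
def weight (p u : ℕ) : IsoClass p → ℝ≥0∞ :=
  Quotient.lift (groupWeight u) (groupWeight_congr u)

/-- The total weight: the sum of `1 / (#A ^ u * #Aut A)` over the isomorphism classes. -/
def totalWeight (p u : ℕ) : ℝ≥0∞ := ∑' A : IsoClass p, weight p u A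

/-- The Cohen–Lenstra measure of unit-rank `u`: the class of `A` has a mass proportional to
`1 / (#A ^ u * #Aut A)`, normalized by the total weight. For `u = 0` it is the groupoid measure. -/
def cohenLenstra (p u : ℕ) : Measure (IsoClass p) :=
  Measure.sum fun A : IsoClass p => (weight p u A / totalWeight p u) • Measure.dirac A

/-- The Shannon entropy `- ∑ x, μ(x) * log μ(x)` of a discrete probability space, with `0 log 0 = 0`.
All terms are nonnegative, so the sum is taken in `[0, ∞]`. -/
def shannonEntropy {X : Type*} [MeasurableSpace X] (μ : Measure X) : ℝ≥0∞ :=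
  ∑' x : X, ENNReal.ofReal (-(μ.real {x} * Real.log (μ.real {x})))

end CohenLenstra

end

/-!
The measures of unit rank `u` and `u + 1` are related by a random quotient: if `A` is distributed
according to the measure of unit rank `u` and `x` is a uniform element of `A`, then `A ⧸ ⟨x⟩` is
distributed according to the measure of unit rank `u + 1` (`tsum_weight_succ_quot`). This rests on
the identity `tsum_natCard_quot_eq_div`: for fixed `B` and `k`, the sum over `A` of
`#{x ∈ A | x has order p ^ k, A ⧸ ⟨x⟩ ≃ B} / #Aut A` is `1 / #Aut B`. It is proved by counting the
surjections from `ℤ[B] × ℤ` onto `A` that send the generator of `ℤ` to such an `x` and the basis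
of `ℤ[B]` to lifts of the elements of `B`. Their kernels are the graphs of the homomorphisms from the
relations of `B`, a free group of rank `#B`, to `ℤ/p^k`, so there are `(p ^ k) ^ #B` kernels, and each
kernel occurs `#Aut A` times for exactly one class `A`.

Everything else follows from the identity.

* Since each term is at most the sum, `#Aut (A ⧸ ⟨x⟩) ≤ #Aut A` (`natCard_addAut_quot_le`).
* Let `a_n` be the sum of `1 / #Aut A` over the groups of order `p ^ n`. Then `a_{n+1} ≤ a_n` and
  `p ^ n * a_n = a_0 + ... + a_n`, so `a_n ≤ (n + 1) / p ^ n`. As `log #Aut A` is at most quadratic in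
  `n`, the entropy is finite, and it is `O(u * p ^ (-u))` (`realEntropy_le`).
* The entropy is `H_u = log Z_u + E_u[g_u]` with `g_u(A) = log (#A ^ u * #Aut A)`. The function `g_u`
  does not increase under quotients, so `E_{u+1}[g_u] ≤ E_u[g_u]`, and
  `H_{u+1} = log Z_{u+1} + E_{u+1}[log #A] + E_{u+1}[g_u]`. By Jensen's inequality
  `E_{u+1}[log #A] < log E_{u+1}[#A] = log (Z_u / Z_{u+1})`, so that `H_{u+1} < H_u`
  (`realEntropy_succ_lt`).
-/

noncomputable section

namespace CohenLenstra

/-! ### Counting quotients by surjections -/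

theorem natCard_addEquiv_of_addEquiv {X A : Type*} [AddCommGroup X] [AddCommGroup A]
    (e : X ≃+ A) : Nat.card (X ≃+ A) = Nat.card (AddAut A) :=
  Nat.card_congr
    { toFun := fun f => e.symm.trans f
      invFun := fun f => e.trans f
      left_inv := fun f => by ext; simp
      right_inv := fun f => by ext; simp }

theorem natCard_addAut_ne_zero (A : Type*) [AddCommGroup A] [Finite A] :
    Nat.card (AddAut A) ≠ 0 :=
  Nat.card_ne_zero.mpr ⟨⟨AddEquiv.refl A⟩, AddEquiv.finite_left⟩

/-- Surjections `G → A` with kernel `Λ` are the same as isomorphisms `G ⧸ Λ ≃ A`. -/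
def surjectiveEquivSigma {G A : Type*} [AddCommGroup G] [AddCommGroup A]
    (L : Set (AddSubgroup G)) :
    {f : G →+ A // Function.Surjective f ∧ f.ker ∈ L} ≃ Σ Λ : L, (G ⧸ Λ.1 ≃+ A) where
  toFun f := ⟨⟨f.1.ker, f.2.2⟩, QuotientAddGroup.quotientKerEquivOfSurjective f.1 f.2.1⟩
  invFun e := ⟨e.2.toAddMonoidHom.comp (QuotientAddGroup.mk' e.1.1),
    e.2.surjective.comp (QuotientAddGroup.mk'_surjective _), by
      have : (e.2.toAddMonoidHom.comp (QuotientAddGroup.mk' e.1.1)).ker = e.1.1 := by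
        ext x; simp
      rw [this]; exact e.1.2⟩
  left_inv f := by ext; rfl
  right_inv := by
    have key : ∀ (Λ : AddSubgroup G) (hΛ : Λ ∈ L) (e : G ⧸ Λ ≃+ A) (f : G →+ A)
        (hf : Function.Surjective f) (hL : f.ker ∈ L), f.ker = Λ → (∀ x : G, f x = e x) →
        (⟨⟨f.ker, hL⟩, QuotientAddGroup.quotientKerEquivOfSurjective f hf⟩ :
          Σ Λ : L, (G ⧸ Λ.1 ≃+ A)) = ⟨⟨Λ, hΛ⟩, e⟩ := by
      rintro _ _ e f _ _ rfl h
      congr 1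
      ext x
      obtain ⟨x, rfl⟩ := QuotientAddGroup.mk_surjective x
      exact h x
    rintro ⟨⟨Λ, hΛ⟩, e⟩
    exact key Λ hΛ e _ _ _ (by ext x; simp) fun x => rfl

/-- The number of automorphisms of a group in the given isomorphism class. -/
def autCard {p : ℕ} (A : IsoClass p) : ℕ := Nat.card (AddAut A.out.carrier)

theorem autCard_ne_zero {p : ℕ} (A : IsoClass p) : autCard A ≠ 0 :=
  natCard_addAut_ne_zero _

theorem mk_out {p : ℕ} (A : IsoClass p) : IsoClass.mk A.out = A := Quotient.out_eq A

theorem mk_eq_iff {p : ℕ} {A : FinAbPGroup p} {C : IsoClass p} :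
    IsoClass.mk A = C ↔ Nonempty (A.carrier ≃+ C.out.carrier) := by
  conv_lhs => rw [← mk_out C]
  exact Quotient.eq (r := isoSetoid p)

/-- A family of quotients of `G` is counted by their surjections: each quotient isomorphic to `A`
contributes exactly `#Aut A` surjections onto `A`. -/
theorem tsum_card_surjective_div {p : ℕ} {G : Type} [AddCommGroup G] (L : Set (AddSubgroup G))
    [Finite L] (hL : ∀ Λ ∈ L, Finite (G ⧸ Λ) ∧ IsPGroup p (Multiplicative (G ⧸ Λ))) :
    ∑' A : IsoClass p,
      (Nat.card {f : G →+ A.out.carrier // Function.Surjective f ∧ f.ker ∈ L} : ℝ≥0∞) / autCard A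
      = Nat.card L := by
  classical
  have := Fintype.ofFinite L
  let c : L → IsoClass p := fun Λ =>
    haveI := (hL Λ.1 Λ.2).1
    IsoClass.mk ⟨G ⧸ Λ.1, (hL Λ.1 Λ.2).2⟩
  have key : ∀ A : IsoClass p,
      (Nat.card {f : G →+ A.out.carrier // Function.Surjective f ∧ f.ker ∈ L} : ℝ≥0∞) / autCard A
      = ∑ Λ : L, if A = c Λ then 1 else 0 := by
    intro A
    have hne : (autCard A : ℝ≥0∞) ≠ 0 := by exact_mod_cast autCard_ne_zero A
    rw [eq_comm, ENNReal.eq_div_iff hne (ENNReal.natCast_ne_top _), Finset.mul_sum,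
      Nat.card_congr (surjectiveEquivSigma L)]
    have : ∀ Λ : L, Finite (G ⧸ Λ.1 ≃+ A.out.carrier) := fun Λ => by
      have := (hL Λ.1 Λ.2).1
      exact AddEquiv.finite_left
    rw [Nat.card_sigma, Nat.cast_sum]
    refine Finset.sum_congr rfl fun Λ _ => ?_
    have hc : A = c Λ ↔ Nonempty (G ⧸ Λ.1 ≃+ A.out.carrier) := by
      rw [eq_comm]
      exact mk_eq_iff
    split_ifs with h
    · obtain ⟨e⟩ := hc.1 h
      rw [natCard_addEquiv_of_addEquiv e, mul_one]
      rfl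
    · have : IsEmpty (G ⧸ Λ.1 ≃+ A.out.carrier) := not_nonempty_iff.1 fun h' => h (hc.2 h')
      simp
  simp_rw [key]
  rw [Summable.tsum_finsetSum (fun _ _ => ENNReal.summable)]
  simp

/-! ### Relations of extensions by a cyclic group -/

/-- The canonical surjection onto `B` from the free abelian group on the set `B`. -/
def freeEval (B : Type*) [AddCommGroup B] : (B →₀ ℤ) →+ B :=
  (Finsupp.linearCombination ℤ (id : B → B)).toAddMonoidHom

@[simp] theorem freeEval_single {B : Type*} [AddCommGroup B] (b : B) (n : ℤ) :
    freeEval B (Finsupp.single b n) = n • b := by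
  simp [freeEval]

/-- The subgroups `Λ` of `ℤ[B] × ℤ` such that, in the quotient by `Λ`, the generator of the factor
`ℤ` has order `m` and the relations of `B` hold exactly modulo that generator: they classify the
extensions of `B` by `ℤ/m`, together with a lift of every element of `B`. -/
def extensionRelations (B : Type*) [AddCommGroup B] (m : ℕ) :
    Set (AddSubgroup ((B →₀ ℤ) × ℤ)) :=
  {Λ | (∀ n : ℤ, ((0 : B →₀ ℤ), n) ∈ Λ ↔ (m : ℤ) ∣ n) ∧
    ∀ v : B →₀ ℤ, (∃ n : ℤ, (v, n) ∈ Λ) ↔ freeEval B v = 0}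

/-- The graph of a homomorphism `f` from the relations of `B` to `ℤ/m`, with `ℤ/m` lifted to `ℤ`. -/
def relationsOfHom (B : Type*) [AddCommGroup B] (m : ℕ) (f : (freeEval B).ker →+ ZMod m) :
    AddSubgroup ((B →₀ ℤ) × ℤ) where
  carrier := {y | ∃ h : y.1 ∈ (freeEval B).ker, (y.2 : ZMod m) = f ⟨y.1, h⟩}
  zero_mem' := ⟨zero_mem _, Int.cast_zero.trans (map_zero f).symm⟩
  add_mem' := by
    rintro ⟨v, n⟩ ⟨w, k⟩ ⟨h, h'⟩ ⟨g, g'⟩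
    refine ⟨add_mem h g, ?_⟩
    have := map_add f ⟨v, h⟩ ⟨w, g⟩
    simp only at h' g'
    rw [← h', ← g'] at this
    simpa using this.symm
  neg_mem' := by
    rintro ⟨v, n⟩ ⟨h, h'⟩
    refine ⟨neg_mem h, ?_⟩
    have := map_neg f ⟨v, h⟩
    simp only at h'
    rw [← h'] at this
    exact (Int.cast_neg n).trans this.symm

theorem relationsOfHom_mem (B : Type*) [AddCommGroup B] (m : ℕ)
    (f : (freeEval B).ker →+ ZMod m) : relationsOfHom B m f ∈ extensionRelations B m := by
  constructor
  · intro n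
    rw [← ZMod.intCast_zmod_eq_zero_iff_dvd]
    have h0 := map_zero f
    constructor
    · rintro ⟨h, h'⟩
      exact h'.trans h0
    · intro h
      exact ⟨zero_mem _, h.trans h0.symm⟩
  · intro v
    constructor
    · rintro ⟨n, h, -⟩
      exact h
    · intro h
      obtain ⟨n, hn⟩ := ZMod.intCast_surjective (f ⟨v, h⟩)
      exact ⟨n, h, hn⟩

theorem relationsOfHom_bijective (B : Type*) [AddCommGroup B] (m : ℕ) :
    Function.Bijective (fun f : (freeEval B).ker →+ ZMod m =>
      (⟨relationsOfHom B m f, relationsOfHom_mem B m f⟩ : extensionRelations B m)) := by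
  constructor
  · intro f g hfg
    ext ⟨v, hv⟩
    obtain ⟨n, hn⟩ := ZMod.intCast_surjective (f ⟨v, hv⟩)
    have h : (v, n) ∈ relationsOfHom B m f := ⟨hv, hn⟩
    have hfg' : relationsOfHom B m f = relationsOfHom B m g := Subtype.ext_iff.1 hfg
    rw [hfg'] at h
    obtain ⟨_, h⟩ := h
    exact hn.symm.trans h
  · rintro ⟨Λ, h1, h2⟩
    choose n hn using fun v : (freeEval B).ker => (h2 v.1).2 v.2
    have huniq : ∀ (v : B →₀ ℤ) (a b : ℤ), (v, a) ∈ Λ → (v, b) ∈ Λ →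
        (a : ZMod m) = (b : ZMod m) := by
      intro v a b ha hb
      have := sub_mem hb ha
      rw [Prod.mk_sub_mk, sub_self, h1] at this
      exact (ZMod.intCast_eq_intCast_iff_dvd_sub a b m).2 this
    refine ⟨⟨⟨fun v => (n v : ZMod m), ?_⟩, ?_⟩, ?_⟩
    · have := huniq 0 _ 0 (hn 0) ((h1 0).2 (dvd_zero _))
      simpa using this
    · intro v w
      have := huniq _ _ _ (hn (v + w)) (add_mem (hn v) (hn w))
      simpa using this
    · ext ⟨v, k⟩
      constructor
      · rintro ⟨h, hk⟩
        have hk' : (k : ZMod m) = (n ⟨v, h⟩ : ZMod m) := hk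
        have h3 := (h1 _).2 ((ZMod.intCast_eq_intCast_iff_dvd_sub _ _ m).1 hk'.symm)
        simpa using add_mem (hn ⟨v, h⟩) h3
      · intro h
        exact ⟨(h2 v).1 ⟨k, h⟩, huniq _ _ _ h (hn ⟨v, (h2 v).1 ⟨k, h⟩⟩)⟩

/-- The relations of a finite group `B` form a free abelian group of rank `#B`, and the elements of
`extensionRelations B m` are the graphs of its homomorphisms to `ℤ/m`. -/
theorem natCard_extensionRelations (B : Type*) [AddCommGroup B] [Finite B] (m : ℕ) :
    Nat.card (extensionRelations B m) = m ^ Nat.card B := by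
  rw [← Nat.card_congr (Equiv.ofBijective _ (relationsOfHom_bijective B m))]
  have := Fintype.ofFinite B
  have hsurj : Function.Surjective (freeEval B) := fun b => ⟨Finsupp.single b 1, by simp⟩
  have hfin : (freeEval B).ker.FiniteIndex := by
    have : Finite ((B →₀ ℤ) ⧸ (freeEval B).ker) :=
      Finite.of_equiv B (QuotientAddGroup.quotientKerEquivOfSurjective _ hsurj).symm.toEquiv
    exact AddSubgroup.finiteIndex_of_finite_quotient
  let R : Submodule ℤ (B →₀ ℤ) := AddSubgroup.toIntSubmodule (freeEval B).ker
  have hrank : Module.finrank ℤ R = Nat.card B := by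
    have := AddSubgroup.finrank_eq_of_finiteIndex (freeEval B).ker
    rw [Nat.card_eq_fintype_card, ← Module.finrank_finsupp_self (R := ℤ) (ι := B)]
    exact this
  have : Module.Free ℤ R := inferInstance
  have : Module.Finite ℤ R := inferInstance
  let b := Module.finBasis ℤ R
  have e1 : ((freeEval B).ker →+ ZMod m) ≃ (R →ₗ[ℤ] ZMod m) :=
    (addMonoidHomLequivInt (A := R) (B := ZMod m) ℤ).toEquiv
  rw [Nat.card_congr (e1.trans (b.constr ℤ).toEquiv.symm), Nat.card_fun, Nat.card_zmod,
    Nat.card_eq_fintype_card (α := Fin _), Fintype.card_fin, hrank]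

/-! ### Quotients by cyclic subgroups -/

theorem natCard_fiber_mk {A : Type*} [AddCommGroup A] (x : A)
    (q : A ⧸ AddSubgroup.zmultiples x) :
    Nat.card {a : A // (a : A ⧸ AddSubgroup.zmultiples x) = q} = addOrderOf x := by
  obtain ⟨a₀, rfl⟩ := QuotientAddGroup.mk_surjective q
  rw [← Nat.card_zmultiples]
  exact Nat.card_congr
    { toFun := fun a => ⟨-a₀ + a.1, QuotientAddGroup.eq.1 a.2.symm⟩
      invFun := fun z => ⟨a₀ + z.1, by
        rw [eq_comm, QuotientAddGroup.eq, neg_add_cancel_left]; exact z.2⟩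
      left_inv := fun a => by ext; simp
      right_inv := fun z => by ext; simp }

/-- An element `x` of `A` of order `m`, together with a set-theoretic section of a surjection
`A → B` with kernel generated by `x`. -/
def SplitData (A B : Type*) [AddCommGroup A] [AddCommGroup B] (m : ℕ) : Type _ :=
  {y : A × (B → A) // addOrderOf y.1 = m ∧
    ∃ e : B ≃+ A ⧸ AddSubgroup.zmultiples y.1, ∀ b, (y.2 b : A ⧸ AddSubgroup.zmultiples y.1) = e b}

/-- The homomorphism `ℤ[B] × ℤ → A` given by a map `s : B → A` and an element `x` of `A`. -/
def homOfSection {A B : Type*} [AddCommGroup A] (x : A) (s : B → A) : (B →₀ ℤ) × ℤ →+ A :=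
  (Finsupp.linearCombination ℤ s).toAddMonoidHom.coprod (zmultiplesHom A x)

theorem homOfSection_apply {A B : Type*} [AddCommGroup A] (x : A) (s : B → A) (v : B →₀ ℤ) (n : ℤ) :
    homOfSection x s (v, n) = Finsupp.linearCombination ℤ s v + n • x := by
  simp [homOfSection]

theorem mk_linearCombination {A B : Type*} [AddCommGroup A] [AddCommGroup B] {x : A} {s : B → A}
    (e : B ≃+ A ⧸ AddSubgroup.zmultiples x)
    (h : ∀ b, (s b : A ⧸ AddSubgroup.zmultiples x) = e b) (v : B →₀ ℤ) :
    ((Finsupp.linearCombination ℤ s v : A) : A ⧸ AddSubgroup.zmultiples x) = e (freeEval B v) := by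
  have : (QuotientAddGroup.mk' (AddSubgroup.zmultiples x)).comp
      (Finsupp.linearCombination ℤ s).toAddMonoidHom = e.toAddMonoidHom.comp (freeEval B) := by
    ext b
    simp [h]
  exact DFunLike.congr_fun this v

theorem homOfSection_mem {A B : Type*} [AddCommGroup A] [AddCommGroup B] {m : ℕ} {x : A}
    {s : B → A} (hx : addOrderOf x = m) (e : B ≃+ A ⧸ AddSubgroup.zmultiples x)
    (h : ∀ b, (s b : A ⧸ AddSubgroup.zmultiples x) = e b) :
    Function.Surjective (homOfSection x s) ∧ (homOfSection x s).ker ∈ extensionRelations B m := by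
  refine ⟨fun a => ?_, fun n => ?_, fun v => ?_⟩
  · obtain ⟨b, hb⟩ := e.surjective (a : A ⧸ AddSubgroup.zmultiples x)
    rw [← h b, QuotientAddGroup.eq] at hb
    obtain ⟨n, hn⟩ := hb
    refine ⟨(Finsupp.single b 1, n), ?_⟩
    simp only at hn
    rw [homOfSection_apply, hn]
    simp
  · rw [AddMonoidHom.mem_ker, homOfSection_apply, ← hx, addOrderOf_dvd_iff_zsmul_eq_zero]
    simp
  · simp_rw [AddMonoidHom.mem_ker, homOfSection_apply]
    rw [← e.map_eq_zero_iff, ← mk_linearCombination e h, QuotientAddGroup.eq_zero_iff,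
      AddSubgroup.mem_zmultiples_iff]
    constructor
    · rintro ⟨n, hn⟩
      exact ⟨-n, by rw [neg_smul, ← eq_neg_of_add_eq_zero_left hn]⟩
    · rintro ⟨n, hn⟩
      exact ⟨-n, by rw [neg_smul, hn, add_neg_cancel]⟩

/-- The converse of `homOfSection_mem`: every surjection whose kernel lies in
`extensionRelations B m` comes from an element `x` of order `m` and a section. -/
theorem exists_section_of_mem {A B : Type*} [AddCommGroup A] [AddCommGroup B] {m : ℕ}
    (f : (B →₀ ℤ) × ℤ →+ A) (hf : Function.Surjective f) (hL : f.ker ∈ extensionRelations B m) :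
    ∃ (x : A) (s : B → A), addOrderOf x = m ∧ (∃ e : B ≃+ A ⧸ AddSubgroup.zmultiples x,
      ∀ b, (s b : A ⧸ AddSubgroup.zmultiples x) = e b) ∧ homOfSection x s = f := by
  obtain ⟨h1, h2⟩ := hL
  have hfa : ∀ v n, f (v, n) = f (v, 0) + n • f (0, 1) := by
    intro v n
    rw [← map_zsmul, ← map_add]
    simp
  have hlin : (Finsupp.linearCombination ℤ fun b => f (Finsupp.single b 1, 0)).toAddMonoidHom
      = f.comp (AddMonoidHom.inl _ _) := by
    ext b
    simp
  have hfs : homOfSection (f (0, 1)) (fun b => f (Finsupp.single b 1, 0)) = f := by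
    refine AddMonoidHom.ext fun ⟨v, n⟩ => ?_
    rw [homOfSection_apply, hfa v n]
    exact congrArg (· + n • f (0, 1)) (DFunLike.congr_fun hlin v)
  -- The composite `ℤ[B] → A → A ⧸ ⟨x⟩` has the same kernel as `ℤ[B] → B`.
  have hker : ∀ v : B →₀ ℤ,
      ((f (v, 0) : A) : A ⧸ AddSubgroup.zmultiples (f (0, 1))) = 0 ↔ freeEval B v = 0 := by
    intro v
    rw [← h2, QuotientAddGroup.eq_zero_iff, AddSubgroup.mem_zmultiples_iff]
    constructor
    · rintro ⟨n, hn⟩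
      exact ⟨-n, by rw [AddMonoidHom.mem_ker, hfa, neg_smul, hn, add_neg_cancel]⟩
    · rintro ⟨n, hn⟩
      rw [AddMonoidHom.mem_ker, hfa] at hn
      exact ⟨-n, by rw [neg_smul, ← eq_neg_of_add_eq_zero_left hn]⟩
  let φ : (B →₀ ℤ) →+ A ⧸ AddSubgroup.zmultiples (f (0, 1)) :=
    (QuotientAddGroup.mk' _).comp (f.comp (AddMonoidHom.inl _ _))
  have hφ : ∀ v w, φ v = φ w ↔ freeEval B v = freeEval B w := by
    intro v w
    rw [← sub_eq_zero, ← map_sub, ← sub_eq_zero (a := freeEval B v), ← map_sub]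
    exact hker _
  have hsingle : ∀ v, φ (Finsupp.single (freeEval B v) 1) = φ v := fun v => by
    rw [hφ]; simp
  let e₀ : B →+ A ⧸ AddSubgroup.zmultiples (f (0, 1)) :=
    AddMonoidHom.mk' (fun b => φ (Finsupp.single b 1)) fun b c => by
      rw [← map_add, hφ]
      simp
  have he₀ : Function.Bijective e₀ := by
    constructor
    · intro b c hbc
      simpa using (hφ _ _).1 hbc
    · intro q
      obtain ⟨a, rfl⟩ := QuotientAddGroup.mk_surjective q
      obtain ⟨⟨v, n⟩, rfl⟩ := hf a
      refine ⟨freeEval B v, (hsingle v).trans ?_⟩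
      change ((f (v, 0) : A) : A ⧸ AddSubgroup.zmultiples (f (0, 1))) = _
      rw [QuotientAddGroup.eq, hfa v n]
      exact ⟨n, by simp⟩
  refine ⟨f (0, 1), fun b => f (Finsupp.single b 1, 0), ?_,
    ⟨AddEquiv.ofBijective e₀ he₀, fun b => rfl⟩, hfs⟩
  refine Nat.dvd_antisymm (addOrderOf_dvd_iff_zsmul_eq_zero.2 ?_ |> Int.natCast_dvd_natCast.1)
    (Int.natCast_dvd_natCast.1 ((h1 _).1 ?_))
  · have := (h1 m).2 dvd_rfl
    rw [AddMonoidHom.mem_ker, hfa] at this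
    simpa [← Prod.zero_eq_mk] using this
  · rw [AddMonoidHom.mem_ker, hfa, natCast_zsmul, addOrderOf_nsmul_eq_zero]
    simp [← Prod.zero_eq_mk]

theorem natCard_splitData_eq_natCard_surjective (A B : Type*) [AddCommGroup A] [AddCommGroup B]
    (m : ℕ) : Nat.card (SplitData A B m) =
      Nat.card {f : (B →₀ ℤ) × ℤ →+ A // Function.Surjective f ∧
        f.ker ∈ extensionRelations B m} := by
  let Φ : SplitData A B m → {f : (B →₀ ℤ) × ℤ →+ A // Function.Surjective f ∧
      f.ker ∈ extensionRelations B m} :=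
    fun y => ⟨homOfSection y.1.1 y.1.2, homOfSection_mem y.2.1 y.2.2.choose y.2.2.choose_spec⟩
  refine Nat.card_congr (Equiv.ofBijective Φ ⟨?_, ?_⟩)
  · rintro ⟨⟨x, s⟩, h⟩ ⟨⟨x', s'⟩, h'⟩ hΦ
    have hf : homOfSection x s = homOfSection x' s' := Subtype.ext_iff.1 hΦ
    have hx : x = x' := by simpa [homOfSection_apply] using DFunLike.congr_fun hf (0, 1)
    have hs : s = s' := by
      funext b
      simpa [homOfSection_apply] using DFunLike.congr_fun hf (Finsupp.single b 1, 0)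
    subst hx hs
    rfl
  · rintro ⟨f, hf, hL⟩
    obtain ⟨x, s, hx, he, h⟩ := exists_section_of_mem f hf hL
    exact ⟨⟨(x, s), hx, he⟩, Subtype.ext h⟩

/-- There are `#Aut B` isomorphisms `B ≃ A ⧸ ⟨x⟩` if there is one, and each element of `B` has `m`
lifts to `A`. -/
theorem natCard_splitData (A B : Type*) [AddCommGroup A] [AddCommGroup B] [Finite A] [Finite B]
    (m : ℕ) : Nat.card (SplitData A B m) =
      Nat.card {x : A // addOrderOf x = m ∧ Nonempty (A ⧸ AddSubgroup.zmultiples x ≃+ B)} *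
        Nat.card (AddAut B) * m ^ Nat.card B := by
  classical
  let X := {x : A // addOrderOf x = m ∧ Nonempty (A ⧸ AddSubgroup.zmultiples x ≃+ B)}
  let S : X → Type _ := fun x => {s : B → A // ∃ e : B ≃+ A ⧸ AddSubgroup.zmultiples x.1,
    ∀ b, (s b : A ⧸ AddSubgroup.zmultiples x.1) = e b}
  have e1 : SplitData A B m ≃ Σ x : X, S x :=
    { toFun := fun y => ⟨⟨y.1.1, y.2.1, y.2.2.elim fun e _ => ⟨e.symm⟩⟩, ⟨y.1.2, y.2.2⟩⟩
      invFun := fun z => ⟨(z.1.1, z.2.1), z.1.2.1, z.2.2⟩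
      left_inv := fun _ => rfl
      right_inv := fun _ => rfl }
  have e2 : ∀ x : X, Nat.card (S x) = Nat.card (AddAut B) * m ^ Nat.card B := by
    rintro ⟨x, hx, ⟨e⟩⟩
    let T := Σ e : B ≃+ A ⧸ AddSubgroup.zmultiples x,
      {s : B → A // ∀ b, (s b : A ⧸ AddSubgroup.zmultiples x) = e b}
    have e3 : T ≃ S ⟨x, hx, ⟨e⟩⟩ := by
      refine Equiv.ofBijective (fun t => ⟨t.2.1, t.1, t.2.2⟩) ⟨?_, ?_⟩
      · rintro ⟨e, s, h⟩ ⟨e', s', h'⟩ hss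
        obtain rfl : s = s' := Subtype.ext_iff.1 hss
        obtain rfl : e = e' := by
          ext b
          rw [← h, ← h']
        rfl
      · rintro ⟨s, e, h⟩
        exact ⟨⟨e, s, h⟩, rfl⟩
    have := Fintype.ofFinite B
    have : Finite (B ≃+ A ⧸ AddSubgroup.zmultiples x) := AddEquiv.finite_left
    have := Fintype.ofFinite (B ≃+ A ⧸ AddSubgroup.zmultiples x)
    rw [← Nat.card_congr e3, Nat.card_sigma]
    have e4 : ∀ e : B ≃+ A ⧸ AddSubgroup.zmultiples x,
        Nat.card {s : B → A // ∀ b, (s b : A ⧸ AddSubgroup.zmultiples x) = e b}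
          = m ^ Nat.card B := by
      intro e
      rw [Nat.card_congr (Equiv.subtypePiEquivPi
        (p := fun b (a : A) => (a : A ⧸ AddSubgroup.zmultiples x) = e b)), Nat.card_pi]
      simp_rw [natCard_fiber_mk, hx]
      simp
    simp_rw [e4]
    rw [Finset.sum_const, smul_eq_mul, Finset.card_univ, ← Nat.card_eq_fintype_card,
      ← natCard_addEquiv_of_addEquiv e]
    exact congrArg (· * _) (Nat.card_congr ⟨AddEquiv.symm, AddEquiv.symm, fun _ => rfl, fun _ => rfl⟩)
  have := Fintype.ofFinite X
  rw [Nat.card_congr e1, Nat.card_sigma]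
  simp_rw [e2]
  rw [Finset.sum_const, smul_eq_mul, Finset.card_univ, ← Nat.card_eq_fintype_card, mul_assoc]

/-- The quotient of a finite abelian `p`-group by the subgroup generated by `x`. -/
def FinAbPGroup.quot {p : ℕ} (A : FinAbPGroup p) (x : A.carrier) : FinAbPGroup p where
  carrier := A.carrier ⧸ AddSubgroup.zmultiples x
  isPGroup := by
    let f : A.carrier →+ A.carrier ⧸ AddSubgroup.zmultiples x := QuotientAddGroup.mk' _
    have hf : Function.Surjective f := QuotientAddGroup.mk'_surjective _
    exact A.isPGroup.of_surjective (AddMonoidHom.toMultiplicative f) hf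

theorem FinAbPGroup.exists_natCard {p : ℕ} (hp : p.Prime) (A : FinAbPGroup p) :
    ∃ n : ℕ, Nat.card A.carrier = p ^ n := by
  have : Fact p.Prime := ⟨hp⟩
  exact (IsPGroup.iff_card (G := Multiplicative A.carrier)).1 A.isPGroup

theorem FinAbPGroup.exists_addOrderOf {p : ℕ} (hp : p.Prime) (A : FinAbPGroup p) (x : A.carrier) :
    ∃ k : ℕ, addOrderOf x = p ^ k := by
  obtain ⟨n, hn⟩ := A.exists_natCard hp
  have hd : addOrderOf x ∣ p ^ n := hn ▸ addOrderOf_dvd_natCard x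
  obtain ⟨k, -, hk⟩ := (Nat.dvd_prime_pow hp).1 hd
  exact ⟨k, hk⟩

theorem FinAbPGroup.natCard_quot {p : ℕ} (A : FinAbPGroup p) (x : A.carrier) :
    Nat.card A.carrier = addOrderOf x * Nat.card (A.quot x).carrier := by
  rw [mul_comm, ← Nat.card_zmultiples]
  exact AddSubgroup.card_eq_card_quotient_mul_card_addSubgroup _

/-- The groupoid of the pairs `(A, x)` with `x` of order `p ^ k` and `A ⧸ ⟨x⟩ ≃ B` has the mass
`1 / #Aut B`. The conceptual reason is that `Ext(B, ℤ/p^k)` and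
`Hom(B, ℤ/p^k)` have the same order; here both sides are multiplied by the number
`(p ^ k) ^ #B` of set-theoretic sections of `A → B`, which makes all structures rigid. -/
theorem tsum_natCard_quot_eq_div {p : ℕ} (hp : p.Prime) (k : ℕ) (B : IsoClass p) :
    ∑' A : IsoClass p, (Nat.card {x : A.out.carrier //
      addOrderOf x = p ^ k ∧ IsoClass.mk (A.out.quot x) = B} : ℝ≥0∞) / autCard A
      = 1 / autCard B := by
  have hm : p ^ k ≠ 0 := pow_ne_zero _ hp.ne_zero
  set b := Nat.card B.out.carrier with hb
  have hb0 : b ≠ 0 := Nat.card_pos.ne'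
  have hcard := natCard_extensionRelations B.out.carrier (p ^ k)
  rw [← hb] at hcard
  have : Finite (extensionRelations B.out.carrier (p ^ k)) :=
    Nat.finite_of_card_ne_zero (by rw [hcard]; exact pow_ne_zero _ hm)
  have hquot : ∀ Λ ∈ extensionRelations B.out.carrier (p ^ k),
      Finite (((B.out.carrier →₀ ℤ) × ℤ) ⧸ Λ) ∧
        IsPGroup p (Multiplicative (((B.out.carrier →₀ ℤ) × ℤ) ⧸ Λ)) := by
    intro Λ hΛ
    obtain ⟨x, s, hx, ⟨e, -⟩, -⟩ := exists_section_of_mem (QuotientAddGroup.mk' Λ)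
      (QuotientAddGroup.mk'_surjective Λ) (by rwa [QuotientAddGroup.ker_mk'])
    obtain ⟨n, hn⟩ := B.out.exists_natCard hp
    have hc : Nat.card (((B.out.carrier →₀ ℤ) × ℤ) ⧸ Λ) = p ^ (n + k) := by
      rw [AddSubgroup.card_eq_card_quotient_mul_card_addSubgroup (AddSubgroup.zmultiples x),
        Nat.card_zmultiples, hx, ← Nat.card_congr e.toEquiv, hn, pow_add]
    exact ⟨Nat.finite_of_card_ne_zero (by rw [hc]; exact pow_ne_zero _ hp.ne_zero),
      IsPGroup.of_card hc⟩
  have h := tsum_card_surjective_div _ hquot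
  simp_rw [← natCard_splitData_eq_natCard_surjective, natCard_splitData] at h
  rw [hcard] at h
  have hB : (autCard B : ℝ≥0∞) ≠ 0 := by exact_mod_cast autCard_ne_zero B
  have hmb : ((p ^ k) ^ b : ℝ≥0∞) ≠ 0 := by exact_mod_cast pow_ne_zero _ hm
  have hmb' : ((p ^ k) ^ b : ℝ≥0∞) ≠ ∞ := by
    exact_mod_cast ENNReal.natCast_ne_top ((p ^ k) ^ b)
  have h2 : ∀ A : IsoClass p, ((Nat.card {x : A.out.carrier // addOrderOf x = p ^ k ∧
      Nonempty (A.out.carrier ⧸ AddSubgroup.zmultiples x ≃+ B.out.carrier)} *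
        Nat.card (AddAut B.out.carrier) * (p ^ k) ^ b : ℕ) : ℝ≥0∞) / autCard A
      = ((p ^ k) ^ b * autCard B) * ((Nat.card {x : A.out.carrier //
      addOrderOf x = p ^ k ∧ IsoClass.mk (A.out.quot x) = B} : ℝ≥0∞) / autCard A) := by
    intro A
    simp_rw [mk_eq_iff]
    change _ = _ * ((Nat.card {x : A.out.carrier // addOrderOf x = p ^ k ∧
      Nonempty (A.out.carrier ⧸ AddSubgroup.zmultiples x ≃+ B.out.carrier)} : ℝ≥0∞) / _)
    rw [← mul_div_assoc]
    congr 1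
    push_cast
    rw [autCard]
    ring
  rw [tsum_congr h2, ENNReal.tsum_mul_left, mul_assoc] at h
  rw [ENNReal.eq_div_iff hB (ENNReal.natCast_ne_top _)]
  refine (ENNReal.mul_right_inj hmb hmb').1 ?_
  rw [h, mul_one]
  push_cast
  rfl

/-- Summing over a group `A` weighted by `1 / #Aut A` and over an element `x` of `A` is the same as
summing over `B = A ⧸ ⟨x⟩` weighted by `1 / #Aut B` and over the order of `x`. -/
theorem tsum_quot {p : ℕ} (hp : p.Prime) (F : ℕ → IsoClass p → ℝ≥0∞) :
    ∑' A : IsoClass p, (∑' x : A.out.carrier, F (addOrderOf x) (IsoClass.mk (A.out.quot x))) /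
      autCard A = ∑' k : ℕ, ∑' B : IsoClass p, F (p ^ k) B / autCard B := by
  classical
  have hF : ∀ (A : IsoClass p) (x : A.out.carrier),
      F (addOrderOf x) (IsoClass.mk (A.out.quot x)) = ∑' k : ℕ, ∑' B : IsoClass p,
        F (p ^ k) B * if addOrderOf x = p ^ k ∧ IsoClass.mk (A.out.quot x) = B then 1 else 0 := by
    intro A x
    obtain ⟨k, hk⟩ := A.out.exists_addOrderOf hp x
    rw [tsum_eq_single k, tsum_eq_single (IsoClass.mk (A.out.quot x))]
    · simp [hk]
    · intro B hB
      simp [hB.symm]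
    · intro j hj
      have : p ^ k ≠ p ^ j := fun h => hj (Nat.pow_right_injective hp.two_le h).symm
      simp [hk, this]
  have hN : ∀ (A : IsoClass p) (k : ℕ) (B : IsoClass p),
      (∑' x : A.out.carrier, if addOrderOf x = p ^ k ∧ IsoClass.mk (A.out.quot x) = B
        then (1 : ℝ≥0∞) else 0) = (Nat.card {x : A.out.carrier //
          addOrderOf x = p ^ k ∧ IsoClass.mk (A.out.quot x) = B} : ℝ≥0∞) := by
    intro A k B
    have := Fintype.ofFinite A.out.carrier
    rw [tsum_fintype, Finset.sum_boole, Nat.card_eq_fintype_card, Fintype.card_subtype]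
  calc _ = ∑' A : IsoClass p, ∑' k : ℕ, ∑' B : IsoClass p, F (p ^ k) B *
        ((Nat.card {x : A.out.carrier //
          addOrderOf x = p ^ k ∧ IsoClass.mk (A.out.quot x) = B} : ℝ≥0∞) / autCard A) := by
        refine tsum_congr fun A => ?_
        simp_rw [hF A]
        rw [ENNReal.tsum_comm]
        simp_rw [div_eq_mul_inv]
        rw [← ENNReal.tsum_mul_right]
        refine tsum_congr fun k => ?_
        rw [ENNReal.tsum_comm, ← ENNReal.tsum_mul_right]
        refine tsum_congr fun B => ?_
        rw [ENNReal.tsum_mul_left, hN, mul_assoc]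
    _ = _ := by
        rw [ENNReal.tsum_comm]
        refine tsum_congr fun k => ?_
        rw [ENNReal.tsum_comm]
        refine tsum_congr fun B => ?_
        rw [ENNReal.tsum_mul_left, tsum_natCard_quot_eq_div hp, mul_one_div]

/-- A quotient by a cyclic subgroup has at most as many automorphisms as the group: the term of `A`
in the sum `tsum_natCard_quot_eq_div` is at least `1 / #Aut A`, and the sum is `1 / #Aut (A ⧸ ⟨x⟩)`. -/
theorem natCard_addAut_quot_le {p : ℕ} (hp : p.Prime) (A : IsoClass p) (x : A.out.carrier) :
    autCard (IsoClass.mk (A.out.quot x)) ≤ autCard A := by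
  obtain ⟨k, hk⟩ := A.out.exists_addOrderOf hp x
  have h := tsum_natCard_quot_eq_div hp k (IsoClass.mk (A.out.quot x))
  have h1 := ENNReal.le_tsum (f := fun C : IsoClass p => (Nat.card {y : C.out.carrier //
      addOrderOf y = p ^ k ∧ IsoClass.mk (C.out.quot y) = IsoClass.mk (A.out.quot x)} : ℝ≥0∞) /
        autCard C) A
  rw [h] at h1
  have h2 : (1 : ℝ≥0∞) ≤ (Nat.card {y : A.out.carrier //
      addOrderOf y = p ^ k ∧ IsoClass.mk (A.out.quot y) = IsoClass.mk (A.out.quot x)} : ℝ≥0∞) := by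
    have : Nat.card {y : A.out.carrier // addOrderOf y = p ^ k ∧
        IsoClass.mk (A.out.quot y) = IsoClass.mk (A.out.quot x)} ≠ 0 :=
      Nat.card_ne_zero.2 ⟨⟨⟨x, hk, rfl⟩⟩, inferInstance⟩
    exact_mod_cast Nat.one_le_iff_ne_zero.2 this
  have h3 := (ENNReal.div_le_div_right h2 (autCard A)).trans h1
  rw [one_div, one_div, ENNReal.inv_le_inv] at h3
  exact_mod_cast h3

/-! ### The number of automorphisms -/

theorem exists_generating_finset (A : Type*) [AddCommGroup A] [Finite A] :
    ∃ S : Finset A, AddSubgroup.closure (S : Set A) = ⊤ ∧ 2 ^ S.card ≤ Nat.card A := by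
  classical
  have := Fintype.ofFinite A
  let P : Finset (Finset A) :=
    {S | 2 ^ S.card ≤ Nat.card (AddSubgroup.closure (S : Set A))}
  have hP : P.Nonempty := ⟨∅, by simp [P]⟩
  obtain ⟨S, hS, hmax⟩ :=
    P.exists_max_image (fun S => Nat.card (AddSubgroup.closure (S : Set A))) hP
  have hS' : 2 ^ S.card ≤ Nat.card (AddSubgroup.closure (S : Set A)) := (Finset.mem_filter.1 hS).2
  refine ⟨S, ?_, hS'.trans (Nat.card_le_card_of_injective _ Subtype.val_injective)⟩
  by_contra hne
  obtain ⟨a, ha⟩ : ∃ a, a ∉ AddSubgroup.closure (S : Set A) := by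
    by_contra! h
    exact hne (eq_top_iff.2 fun a _ => h a)
  have hle : AddSubgroup.closure (S : Set A) ≤ AddSubgroup.closure ((insert a S : Finset A) : Set A) :=
    AddSubgroup.closure_mono (by simp)
  have hmem : a ∈ AddSubgroup.closure ((insert a S : Finset A) : Set A) :=
    AddSubgroup.subset_closure (by simp)
  -- A strictly larger subgroup has at least twice as many elements.
  have h2 : 2 * Nat.card (AddSubgroup.closure (S : Set A)) ≤
      Nat.card (AddSubgroup.closure ((insert a S : Finset A) : Set A)) := by
    obtain ⟨d, hd⟩ := AddSubgroup.card_dvd_of_le hle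
    have hpos : 0 < Nat.card (AddSubgroup.closure ((insert a S : Finset A) : Set A)) := Nat.card_pos
    rcases d with _ | _ | d
    · exact absurd hpos (by rw [hd]; simp)
    · have := AddSubgroup.eq_of_le_of_card_ge hle (by rw [hd]; simp)
      rw [this] at ha
      exact absurd hmem ha
    · rw [hd]
      nlinarith
  have hpos : 0 < Nat.card (AddSubgroup.closure (S : Set A)) := Nat.card_pos
  have hin : insert a S ∈ P := by
    refine Finset.mem_filter.2 ⟨Finset.mem_univ _, ?_⟩
    calc 2 ^ (insert a S).card ≤ 2 ^ (S.card + 1) :=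
          Nat.pow_le_pow_right two_pos (Finset.card_insert_le _ _)
      _ = 2 * 2 ^ S.card := pow_succ' _ _
      _ ≤ _ := (Nat.mul_le_mul_left 2 hS').trans h2
  have := hmax _ hin
  omega

/-- An automorphism is determined by the images of at most `log₂ #A` generators. -/
theorem natCard_addAut_le (A : Type*) [AddCommGroup A] [Finite A] :
    Nat.card (AddAut A) ≤ Nat.card A ^ Nat.log 2 (Nat.card A) := by
  obtain ⟨S, hS, hc⟩ := exists_generating_finset A
  have hinj : Function.Injective (fun (f : AddAut A) (s : S) => f s.1) := by
    intro f g hfg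
    have : f.toAddMonoidHom = g.toAddMonoidHom :=
      AddMonoidHom.eq_of_eqOn_dense hS fun s hs => congrFun hfg ⟨s, hs⟩
    exact AddEquiv.ext fun a => DFunLike.congr_fun this a
  calc Nat.card (AddAut A) ≤ Nat.card (S → A) := Nat.card_le_card_of_injective _ hinj
    _ = Nat.card A ^ S.card := by rw [Nat.card_fun]; simp
    _ ≤ _ := Nat.pow_le_pow_right Nat.card_pos
        (Nat.le_log_of_pow_le one_lt_two hc)

/-- The order of a group in the given isomorphism class. -/
def groupCard {p : ℕ} (A : IsoClass p) : ℕ := Nat.card A.out.carrier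

theorem groupCard_pos {p : ℕ} (A : IsoClass p) : 0 < groupCard A := Nat.card_pos

theorem groupCard_mk {p : ℕ} (A : FinAbPGroup p) :
    groupCard (IsoClass.mk A) = Nat.card A.carrier := by
  obtain ⟨e⟩ := mk_eq_iff.1 (rfl : IsoClass.mk A = IsoClass.mk A)
  exact (Nat.card_congr e.toEquiv).symm

theorem groupCard_eq_mul_quot {p : ℕ} (A : IsoClass p) (x : A.out.carrier) :
    groupCard A = addOrderOf x * groupCard (IsoClass.mk (A.out.quot x)) := by
  rw [groupCard_mk]
  exact A.out.natCard_quot x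

/-- The integer `n` such that the groups of the given isomorphism class have order `p ^ n`. -/
def exponent {p : ℕ} (A : IsoClass p) : ℕ := Nat.log p (groupCard A)

theorem groupCard_eq_pow {p : ℕ} (hp : p.Prime) (A : IsoClass p) :
    groupCard A = p ^ exponent A := by
  obtain ⟨n, hn⟩ := A.out.exists_natCard hp
  rw [exponent, groupCard, hn, Nat.log_pow hp.one_lt]

theorem autCard_le {p : ℕ} (A : IsoClass p) :
    autCard A ≤ groupCard A ^ Nat.log 2 (groupCard A) := natCard_addAut_le _

/-- The class of the trivial group. -/
def trivialClass (p : ℕ) : IsoClass p :=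
  IsoClass.mk ⟨Unit, IsPGroup.of_card (n := 0) (by simp)⟩

theorem groupCard_trivialClass (p : ℕ) : groupCard (trivialClass p) = 1 := by
  rw [trivialClass, groupCard_mk]
  simp

theorem eq_trivialClass {p : ℕ} {A : IsoClass p} (h : groupCard A = 1) : A = trivialClass p := by
  rw [eq_comm, trivialClass, mk_eq_iff]
  have : Subsingleton A.out.carrier := (Nat.card_eq_one_iff_unique.1 h).1
  have := uniqueOfSubsingleton (0 : A.out.carrier)
  exact ⟨AddEquiv.ofUnique⟩

theorem autCard_eq_one {p : ℕ} {A : IsoClass p} (h : groupCard A = 1) : autCard A = 1 := by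
  have h1 := autCard_le A
  have h2 := autCard_ne_zero A
  rw [h] at h1
  simp at h1
  omega

/-! ### The mass of the groups of a given order -/

/-- The sum of `1 / #Aut A` over the isomorphism classes of groups of order `p ^ n`. -/
def massOfExponent (p n : ℕ) : ℝ≥0∞ :=
  open Classical in ∑' A : IsoClass p, (if groupCard A = p ^ n then 1 else 0) / (autCard A : ℝ≥0∞)

theorem massOfExponent_le_one {p : ℕ} (hp : p.Prime) (n : ℕ) : massOfExponent p n ≤ 1 := by
  classical
  induction n with
  | zero =>
    rw [massOfExponent, tsum_eq_single (trivialClass p)]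
    · have h := groupCard_trivialClass p
      simp [h, autCard_eq_one h]
    · intro A hA
      have : groupCard A ≠ 1 := fun h => hA (eq_trivialClass h)
      simp [this]
  | succ n ih =>
    -- A group of order `p ^ (n + 1)` has an element of order `p`, hence a quotient of order `p ^ n`.
    refine le_trans ?_ ih
    let F : ℕ → IsoClass p → ℝ≥0∞ := fun m B => if m = p ∧ groupCard B = p ^ n then 1 else 0
    have h := tsum_quot hp F
    have hr : ∑' k : ℕ, ∑' B : IsoClass p, F (p ^ k) B / (autCard B : ℝ≥0∞)
        = massOfExponent p n := by
      rw [tsum_eq_single 1]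
      · rw [massOfExponent]
        simp [F]
      · intro k hk
        have : p ^ k ≠ p := fun h => hk (Nat.pow_right_injective hp.two_le (by simpa using h))
        simp [F, this]
    rw [← hr, ← h, massOfExponent]
    refine ENNReal.tsum_le_tsum fun A => ENNReal.div_le_div_right ?_ _
    split_ifs with hA
    · have : Fact p.Prime := ⟨hp⟩
      obtain ⟨x, hx⟩ := exists_prime_addOrderOf_dvd_card' (G := A.out.carrier) p
        (by rw [← groupCard, hA]; exact dvd_pow_self p n.succ_ne_zero)
      have hq := groupCard_eq_mul_quot A x
      rw [hA, hx, pow_succ', Nat.mul_right_inj hp.ne_zero] at hq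
      calc (1 : ℝ≥0∞) = F (addOrderOf x) (IsoClass.mk (A.out.quot x)) := by
            simp [F, hx, ← hq]
        _ ≤ _ := ENNReal.le_tsum x
    · exact zero_le

/-- Counting the elements of all groups of order `p ^ n` by the quotients that they define expresses
`p ^ n` times the mass in exponent `n` as the sum of the masses in the exponents up to `n`. -/
theorem pow_mul_massOfExponent_le {p : ℕ} (hp : p.Prime) (n : ℕ) :
    (p : ℝ≥0∞) ^ n * massOfExponent p n ≤ n + 1 := by
  classical
  let F : ℕ → IsoClass p → ℝ≥0∞ := fun m B => if m * groupCard B = p ^ n then 1 else 0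
  have h := tsum_quot hp F
  have hl : ∀ A : IsoClass p,
      (∑' x : A.out.carrier, F (addOrderOf x) (IsoClass.mk (A.out.quot x))) / (autCard A : ℝ≥0∞)
      = (p : ℝ≥0∞) ^ n * ((if groupCard A = p ^ n then 1 else 0) / (autCard A : ℝ≥0∞)) := by
    intro A
    have := Fintype.ofFinite A.out.carrier
    simp_rw [F, ← groupCard_eq_mul_quot]
    rw [tsum_fintype, Finset.sum_const, Finset.card_univ, ← Nat.card_eq_fintype_card, ← groupCard,
      ← mul_div_assoc]
    split_ifs with hA
    · simp [hA]
    · simp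
  simp_rw [hl] at h
  rw [ENNReal.tsum_mul_left] at h
  rw [massOfExponent, h, tsum_eq_sum (s := Finset.range (n + 1))]
  · calc _ ≤ ∑ k ∈ Finset.range (n + 1), (1 : ℝ≥0∞) := by
          refine Finset.sum_le_sum fun k hk => ?_
          refine le_trans (ENNReal.tsum_le_tsum fun B => ?_) (massOfExponent_le_one hp (n - k))
          refine ENNReal.div_le_div_right ?_ _
          have hk' : k ≤ n := Nat.lt_succ_iff.1 (Finset.mem_range.1 hk)
          have : p ^ k * groupCard B = p ^ n ↔ groupCard B = p ^ (n - k) := by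
            rw [show p ^ n = p ^ k * p ^ (n - k) by rw [← pow_add, Nat.add_sub_cancel' hk'],
              Nat.mul_right_inj (pow_ne_zero k hp.ne_zero)]
          simp [F, this]
      _ = n + 1 := by simp
  · intro k hk
    have hk' : n < k := by simpa using hk
    rw [ENNReal.tsum_eq_zero]
    intro B
    have : p ^ k * groupCard B ≠ p ^ n := by
      have h1 := Nat.pow_lt_pow_right hp.one_lt hk'
      exact (h1.trans_le (Nat.le_mul_of_pos_right _ (groupCard_pos B))).ne'
    simp [F, this]

theorem tsum_exponent {p : ℕ} (hp : p.Prime) (φ : ℕ → ℝ≥0∞) :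
    ∑' A : IsoClass p, φ (exponent A) / (autCard A : ℝ≥0∞) = ∑' n, φ n * massOfExponent p n := by
  classical
  simp_rw [massOfExponent, ← ENNReal.tsum_mul_left]
  rw [ENNReal.tsum_comm]
  refine tsum_congr fun A => ?_
  rw [tsum_eq_single (exponent A)]
  · rw [if_pos (groupCard_eq_pow hp A), mul_one_div]
  · intro n hn
    have : groupCard A ≠ p ^ n := fun h =>
      hn (Nat.pow_right_injective hp.two_le (h.symm.trans (groupCard_eq_pow hp A)))
    simp [this]

theorem summable_sq_exponent_div {p : ℕ} (hp : p.Prime) :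
    Summable fun A : IsoClass p => ((exponent A : ℝ) + 1) ^ 2 / autCard A := by
  have hp0 : (p : ℝ) ≠ 0 := by exact_mod_cast hp.ne_zero
  have hs : Summable fun n : ℕ => ((n : ℝ) + 1) ^ 3 * ((p : ℝ)⁻¹) ^ n := by
    have h1 : ‖(p : ℝ)⁻¹‖ < 1 := by
      rw [norm_inv, Real.norm_natCast]
      exact inv_lt_one_of_one_lt₀ (by exact_mod_cast hp.one_lt)
    have h2 := (summable_nat_add_iff (f := fun n : ℕ => (n : ℝ) ^ 3 * ((p : ℝ)⁻¹) ^ n) 1).2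
      (summable_pow_mul_geometric_of_norm_lt_one 3 h1)
    refine (h2.mul_right (p : ℝ)).congr fun n => ?_
    push_cast
    rw [pow_succ (p : ℝ)⁻¹ n]
    field_simp
  have hfin : ∑' A : IsoClass p, ((exponent A : ℝ≥0∞) + 1) ^ 2 / (autCard A : ℝ≥0∞) ≠ ∞ := by
    rw [tsum_exponent hp fun n => ((n : ℝ≥0∞) + 1) ^ 2]
    refine ne_top_of_le_ne_top hs.tsum_ofReal_ne_top (ENNReal.tsum_le_tsum fun n => ?_)
    have hpn : (p : ℝ≥0∞) ^ n ≠ 0 := pow_ne_zero _ (by exact_mod_cast hp.ne_zero)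
    have hpn' : (p : ℝ≥0∞) ^ n ≠ ∞ := ENNReal.pow_ne_top (ENNReal.natCast_ne_top _)
    have hm : massOfExponent p n ≤ (n + 1) / (p : ℝ≥0∞) ^ n := by
      rw [ENNReal.le_div_iff_mul_le (Or.inl hpn) (Or.inl hpn'), mul_comm]
      exact pow_mul_massOfExponent_le hp n
    calc _ ≤ ((n : ℝ≥0∞) + 1) ^ 2 * ((n + 1) / (p : ℝ≥0∞) ^ n) := by gcongr
      _ = _ := by
        rw [ENNReal.ofReal_mul (by positivity), ENNReal.ofReal_pow (by positivity),
          ENNReal.ofReal_add (by positivity) zero_le_one, ENNReal.ofReal_natCast,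
          ENNReal.ofReal_one, inv_pow, ENNReal.ofReal_inv_of_pos (by positivity),
          ENNReal.ofReal_pow (by positivity), ENNReal.ofReal_natCast, div_eq_mul_inv]
        ring
  refine (ENNReal.summable_toReal hfin).congr fun A => ?_
  rw [ENNReal.toReal_div, ENNReal.toReal_pow, ENNReal.toReal_add (by simp) (by simp)]
  simp

/-! ### Weights and their logarithms as real numbers -/

theorem weight_eq {p : ℕ} (u : ℕ) (A : IsoClass p) :
    weight p u A = ((groupCard A : ℝ≥0∞) ^ u * (autCard A : ℝ≥0∞))⁻¹ := by
  conv_lhs => rw [← mk_out A]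
  rfl

/-- The weight `1 / (#A ^ u * #Aut A)` as a real number. -/
def realWeight {p : ℕ} (u : ℕ) (A : IsoClass p) : ℝ :=
  ((groupCard A : ℝ) ^ u * autCard A)⁻¹

/-- The sum of the weights `1 / (#A ^ u * #Aut A)` as a real number. -/
def realTotalWeight (p u : ℕ) : ℝ := ∑' A : IsoClass p, realWeight u A

/-- The negative logarithm `log (#A ^ u * #Aut A)` of the weight of `A`. -/
def logCost {p : ℕ} (u : ℕ) (A : IsoClass p) : ℝ :=
  u * Real.log (groupCard A) + Real.log (autCard A)

theorem one_le_groupCard {p : ℕ} (A : IsoClass p) : (1 : ℝ) ≤ groupCard A := by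
  exact_mod_cast groupCard_pos A

theorem one_le_autCard {p : ℕ} (A : IsoClass p) : (1 : ℝ) ≤ autCard A := by
  exact_mod_cast Nat.one_le_iff_ne_zero.2 (autCard_ne_zero A)

theorem realWeight_pos {p : ℕ} (u : ℕ) (A : IsoClass p) : 0 < realWeight u A := by
  have h1 := one_le_groupCard A
  have h2 := one_le_autCard A
  unfold realWeight
  positivity

theorem logCost_nonneg {p : ℕ} (u : ℕ) (A : IsoClass p) : 0 ≤ logCost u A := by
  have h1 := Real.log_nonneg (one_le_groupCard A)
  have h2 := Real.log_nonneg (one_le_autCard A)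
  unfold logCost
  positivity

theorem log_realWeight {p : ℕ} (u : ℕ) (A : IsoClass p) :
    Real.log (realWeight u A) = -logCost u A := by
  have h1 := one_le_groupCard A
  have h2 := one_le_autCard A
  rw [realWeight, logCost, Real.log_inv, Real.log_mul (by positivity) (by positivity), Real.log_pow]

theorem logCost_succ {p : ℕ} (u : ℕ) (A : IsoClass p) :
    logCost (u + 1) A = logCost u A + Real.log (groupCard A) := by
  simp only [logCost]
  push_cast
  ring

theorem realWeight_eq_mul_succ {p : ℕ} (u : ℕ) (A : IsoClass p) :
    realWeight u A = realWeight (u + 1) A * groupCard A := by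
  have h1 := one_le_groupCard A
  have h2 := one_le_autCard A
  simp only [realWeight, pow_succ]
  field_simp

theorem weight_eq_ofReal {p : ℕ} (u : ℕ) (A : IsoClass p) :
    weight p u A = ENNReal.ofReal (realWeight u A) := by
  have h1 := one_le_groupCard A
  have h2 := one_le_autCard A
  rw [weight_eq, realWeight, ENNReal.ofReal_inv_of_pos (by positivity),
    ENNReal.ofReal_mul (by positivity), ENNReal.ofReal_pow (by positivity)]
  simp

theorem realWeight_le {p : ℕ} (u : ℕ) (A : IsoClass p) : realWeight u A ≤ 1 / autCard A := by
  have h1 := one_le_groupCard A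
  have h2 := one_le_autCard A
  rw [realWeight, ← one_div]
  exact one_div_le_one_div_of_le (by positivity)
    (le_mul_of_one_le_left (by positivity) (one_le_pow₀ h1))

/-- The constant in the bound of `logCost` by the square of the exponent. -/
def logCostConst (p : ℕ) : ℝ := Real.log p + Real.log p ^ 2 / Real.log 2

theorem logCostConst_nonneg (p : ℕ) : 0 ≤ logCostConst p := by
  have h1 := Real.log_natCast_nonneg p
  have h2 := Real.log_nonneg one_le_two
  unfold logCostConst
  positivity

theorem log_groupCard {p : ℕ} (hp : p.Prime) (A : IsoClass p) :
    Real.log (groupCard A) = exponent A * Real.log p := by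
  rw [groupCard_eq_pow hp A]
  push_cast
  rw [Real.log_pow]

theorem log_autCard_le {p : ℕ} (A : IsoClass p) :
    Real.log (autCard A) ≤ Real.log (groupCard A) ^ 2 / Real.log 2 := by
  have h1 := one_le_groupCard A
  have h2 := one_le_autCard A
  have hl := Real.log_nonneg h1
  have hlog2 : 0 < Real.log 2 := Real.log_pos one_lt_two
  have h3 : (autCard A : ℝ) ≤ (groupCard A : ℝ) ^ Nat.log 2 (groupCard A) := by
    exact_mod_cast autCard_le A
  have h4 := Real.log_le_log (by positivity) h3
  rw [Real.log_pow] at h4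
  have h5 : (2 : ℝ) ^ Nat.log 2 (groupCard A) ≤ groupCard A := by
    exact_mod_cast Nat.pow_log_le_self 2 (groupCard_pos A).ne'
  have h6 := Real.log_le_log (by positivity) h5
  rw [Real.log_pow, ← le_div_iff₀ hlog2] at h6
  calc _ ≤ Real.log (groupCard A) / Real.log 2 * Real.log (groupCard A) :=
        h4.trans (mul_le_mul_of_nonneg_right h6 hl)
    _ = _ := by ring

theorem logCost_le {p : ℕ} (hp : p.Prime) (u : ℕ) (A : IsoClass p) :
    logCost u A ≤ (u + 1) * logCostConst p * (exponent A + 1) ^ 2 := by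
  have h1 := log_autCard_le A
  have hlp := Real.log_natCast_nonneg p
  have hlog2 : 0 < Real.log 2 := Real.log_pos one_lt_two
  rw [log_groupCard hp] at h1
  rw [logCost, log_groupCard hp]
  have hn : (0 : ℝ) ≤ exponent A := Nat.cast_nonneg _
  have hu : (0 : ℝ) ≤ u := Nat.cast_nonneg _
  set n : ℝ := (exponent A : ℝ)
  set l := Real.log p
  have h2 : (n * l) ^ 2 / Real.log 2 = n ^ 2 * (l ^ 2 / Real.log 2) := by ring
  rw [h2] at h1
  have hq : 0 ≤ l ^ 2 / Real.log 2 := by positivity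
  rw [logCostConst]
  set q := l ^ 2 / Real.log 2
  have e1 : u * (n * l) ≤ (u + 1) * (n + 1) ^ 2 * l := by
    have : u * n ≤ (u + 1) * (n + 1) ^ 2 := by nlinarith [mul_nonneg hu hn, mul_nonneg hu (sq_nonneg n)]
    calc _ = u * n * l := by ring
      _ ≤ _ := mul_le_mul_of_nonneg_right this hlp
  have e2 : n ^ 2 * q ≤ (u + 1) * (n + 1) ^ 2 * q := by
    refine mul_le_mul_of_nonneg_right ?_ hq
    nlinarith [mul_nonneg hu hn, mul_nonneg hu (sq_nonneg n)]
  calc _ ≤ (u + 1) * (n + 1) ^ 2 * l + (u + 1) * (n + 1) ^ 2 * q := by linarith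
    _ = _ := by change _ = (u + 1) * (l + q) * (n + 1) ^ 2; ring

theorem summable_realWeight_mul_of_le {p : ℕ} (hp : p.Prime) (u : ℕ) {f : IsoClass p → ℝ} {C : ℝ}
    (h0 : ∀ A, 0 ≤ f A) (hf : ∀ A, f A ≤ C * ((exponent A : ℝ) + 1) ^ 2) :
    Summable fun A : IsoClass p => realWeight u A * f A := by
  refine Summable.of_nonneg_of_le (fun A => mul_nonneg (realWeight_pos u A).le (h0 A)) (fun A => ?_)
    ((summable_sq_exponent_div hp).mul_left C)
  have h2 := one_le_autCard A
  calc _ ≤ 1 / (autCard A : ℝ) * (C * ((exponent A : ℝ) + 1) ^ 2) :=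
        mul_le_mul (realWeight_le u A) (hf A) (h0 A) (by positivity)
    _ = _ := by ring

theorem summable_realWeight {p : ℕ} (hp : p.Prime) (u : ℕ) :
    Summable fun A : IsoClass p => realWeight u A := by
  refine (summable_realWeight_mul_of_le hp u (f := fun _ => 1) (C := 1) (fun _ => zero_le_one)
    fun A => ?_).congr fun A => mul_one _
  have hn : (0 : ℝ) ≤ exponent A := Nat.cast_nonneg _
  nlinarith

theorem summable_realWeight_mul_logCost {p : ℕ} (hp : p.Prime) (u v : ℕ) :
    Summable fun A : IsoClass p => realWeight u A * logCost v A :=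
  summable_realWeight_mul_of_le hp u (logCost_nonneg v) (logCost_le hp v)

theorem summable_realWeight_mul_log {p : ℕ} (hp : p.Prime) (u : ℕ) :
    Summable fun A : IsoClass p => realWeight u A * Real.log (groupCard A) :=
  ((summable_realWeight_mul_logCost hp u 1).sub (summable_realWeight_mul_logCost hp u 0)).congr
    fun A => by simp only [← mul_sub, logCost_succ 0 A, add_sub_cancel_left]

theorem realTotalWeight_pos {p : ℕ} (hp : p.Prime) (u : ℕ) : 0 < realTotalWeight p u :=
  (summable_realWeight hp u).tsum_pos (fun A => (realWeight_pos u A).le) (trivialClass p)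
    (realWeight_pos u _)

theorem realWeight_trivialClass (p u : ℕ) : realWeight u (trivialClass p) = 1 := by
  have h := groupCard_trivialClass p
  simp [realWeight, h, autCard_eq_one h]

theorem one_le_realTotalWeight {p : ℕ} (hp : p.Prime) (u : ℕ) : 1 ≤ realTotalWeight p u := by
  rw [← realWeight_trivialClass p u]
  exact (summable_realWeight hp u).le_tsum _ fun A _ => (realWeight_pos u A).le

theorem totalWeight_eq {p : ℕ} (hp : p.Prime) (u : ℕ) :
    totalWeight p u = ENNReal.ofReal (realTotalWeight p u) := by
  rw [totalWeight, realTotalWeight, ENNReal.ofReal_tsum_of_nonneg (fun A => (realWeight_pos u A).le)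
    (summable_realWeight hp u)]
  exact tsum_congr fun A => weight_eq_ofReal u A

/-! ### The measure and its entropy -/

theorem isProbabilityMeasure_cohenLenstra {p : ℕ} (hp : p.Prime) (u : ℕ) :
    IsProbabilityMeasure (cohenLenstra p u) := by
  constructor
  have h0 := realTotalWeight_pos hp u
  rw [cohenLenstra, Measure.sum_apply _ MeasurableSet.univ]
  simp only [Measure.smul_apply, measure_univ, smul_eq_mul, mul_one, div_eq_mul_inv]
  rw [ENNReal.tsum_mul_right, ← totalWeight, totalWeight_eq hp]
  exact ENNReal.mul_inv_cancel (by simpa using h0) ENNReal.ofReal_ne_top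

theorem cohenLenstra_real_singleton {p : ℕ} (hp : p.Prime) (u : ℕ) (A : IsoClass p) :
    (cohenLenstra p u).real {A} = realWeight u A / realTotalWeight p u := by
  have h0 := realTotalWeight_pos hp u
  have hm : MeasurableSet ({A} : Set (IsoClass p)) := trivial
  rw [Measure.real, cohenLenstra, Measure.sum_apply _ hm, tsum_eq_single A]
  · rw [Measure.smul_apply, Measure.dirac_apply' _ hm, totalWeight_eq hp, weight_eq_ofReal,
      ← ENNReal.ofReal_div_of_pos h0]
    simp only [Set.mem_singleton_iff, Set.indicator_of_mem, Pi.one_apply, smul_eq_mul, mul_one]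
    exact ENNReal.toReal_ofReal (div_nonneg (realWeight_pos u A).le h0.le)
  · intro B hB
    rw [Measure.smul_apply, Measure.dirac_apply' _ hm]
    simp [hB]

/-- The entropy as a real number: `log Z` plus the mean of the negative logarithm of the weight. -/
def realEntropy (p u : ℕ) : ℝ :=
  Real.log (realTotalWeight p u) +
    (∑' A : IsoClass p, realWeight u A * logCost u A) / realTotalWeight p u

theorem realEntropy_nonneg {p : ℕ} (hp : p.Prime) (u : ℕ) : 0 ≤ realEntropy p u :=
  add_nonneg (Real.log_nonneg (one_le_realTotalWeight hp u))
    (div_nonneg (tsum_nonneg fun A => mul_nonneg (realWeight_pos u A).le (logCost_nonneg u A))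
      (realTotalWeight_pos hp u).le)

theorem shannonEntropy_cohenLenstra {p : ℕ} (hp : p.Prime) (u : ℕ) :
    shannonEntropy (cohenLenstra p u) = ENNReal.ofReal (realEntropy p u) := by
  have h0 := realTotalWeight_pos hp u
  set Z := realTotalWeight p u with hZ
  have hterm : ∀ A : IsoClass p,
      -((cohenLenstra p u).real {A} * Real.log ((cohenLenstra p u).real {A}))
        = realWeight u A * (Real.log Z / Z) + realWeight u A * logCost u A / Z := by
    intro A
    rw [cohenLenstra_real_singleton hp, ← hZ, Real.log_div (realWeight_pos u A).ne' h0.ne',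
      log_realWeight]
    ring
  have hs1 := (summable_realWeight hp u).mul_right (Real.log Z / Z)
  have hs2 := (summable_realWeight_mul_logCost hp u u).div_const Z
  have hlog : 0 ≤ Real.log Z := Real.log_nonneg (one_le_realTotalWeight hp u)
  rw [shannonEntropy]
  simp_rw [hterm]
  rw [← ENNReal.ofReal_tsum_of_nonneg _ (hs1.add hs2), hs1.tsum_add hs2, tsum_mul_right,
    tsum_div_const, ← realTotalWeight, ← hZ, mul_div_cancel₀ _ h0.ne', realEntropy]
  intro A
  have h1 := (realWeight_pos u A).le
  have h2 := logCost_nonneg u A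
  positivity

/-! ### Monotonicity in the unit rank -/

/-- Passing from `u` to `u + 1` amounts to taking the quotient of `A` by a random cyclic
subgroup. -/
theorem tsum_weight_succ_quot {p : ℕ} (hp : p.Prime) (u : ℕ) (f : IsoClass p → ℝ≥0∞) :
    ∑' A : IsoClass p, (∑' x : A.out.carrier, f (IsoClass.mk (A.out.quot x))) * weight p (u + 1) A
      = (∑' k : ℕ, (((p : ℝ≥0∞) ^ k) ^ (u + 1))⁻¹) * ∑' B : IsoClass p, f B * weight p (u + 1) B := by
  have h := tsum_quot hp fun m B => f B * (((m : ℝ≥0∞) * groupCard B) ^ (u + 1))⁻¹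
  rw [← ENNReal.tsum_mul_right]
  simp_rw [← ENNReal.tsum_mul_left]
  have hinv : ∀ a b : ℕ, ((a : ℝ≥0∞) ^ (u + 1) * b)⁻¹ = ((a : ℝ≥0∞) ^ (u + 1))⁻¹ * (b : ℝ≥0∞)⁻¹ :=
    fun a b => ENNReal.mul_inv (Or.inr (ENNReal.natCast_ne_top b))
      (Or.inl (ENNReal.pow_ne_top (ENNReal.natCast_ne_top a)))
  have hinv' : ∀ a b : ℕ, (((a : ℝ≥0∞) * b) ^ (u + 1))⁻¹
      = ((a : ℝ≥0∞) ^ (u + 1))⁻¹ * ((b : ℝ≥0∞) ^ (u + 1))⁻¹ := fun a b => by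
    rw [mul_pow]
    exact ENNReal.mul_inv (Or.inr (ENNReal.pow_ne_top (ENNReal.natCast_ne_top b)))
      (Or.inl (ENNReal.pow_ne_top (ENNReal.natCast_ne_top a)))
  refine Eq.trans (tsum_congr fun A => ?_) (h.trans (tsum_congr fun k => tsum_congr fun B => ?_))
  · have hx : ∀ x : A.out.carrier, (addOrderOf x : ℝ≥0∞) *
        groupCard (IsoClass.mk (A.out.quot x)) = groupCard A := fun x => by
      rw [groupCard_eq_mul_quot A x]
      push_cast
      rfl
    simp_rw [hx]
    rw [ENNReal.tsum_mul_right, weight_eq, hinv, div_eq_mul_inv, mul_assoc]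
  · rw [weight_eq, hinv, hinv', div_eq_mul_inv]
    push_cast
    ring

theorem card_mul_weight_succ {p : ℕ} (u : ℕ) (A : IsoClass p) :
    (groupCard A : ℝ≥0∞) * weight p (u + 1) A = weight p u A := by
  rw [weight_eq_ofReal, weight_eq_ofReal, realWeight_eq_mul_succ u A,
    ENNReal.ofReal_mul (realWeight_pos _ _).le, ENNReal.ofReal_natCast, mul_comm]

theorem tsum_carrier_const {p : ℕ} (A : IsoClass p) (c : ℝ≥0∞) :
    ∑' _ : A.out.carrier, c = groupCard A * c := by
  have := Fintype.ofFinite A.out.carrier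
  rw [tsum_fintype, Finset.sum_const, Finset.card_univ, ← Nat.card_eq_fintype_card, nsmul_eq_mul,
    groupCard]

/-- A function that decreases under quotients by cyclic subgroups has a smaller mean for the unit
rank `u + 1` than for the unit rank `u`. -/
theorem tsum_mul_weight_succ_mul_le {p : ℕ} (hp : p.Prime) (u : ℕ) (f : IsoClass p → ℝ≥0∞)
    (hf : ∀ (A : IsoClass p) (x : A.out.carrier), f (IsoClass.mk (A.out.quot x)) ≤ f A) :
    (∑' A : IsoClass p, f A * weight p (u + 1) A) * totalWeight p u ≤
      (∑' A : IsoClass p, f A * weight p u A) * totalWeight p (u + 1) := by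
  set κ : ℝ≥0∞ := ∑' k : ℕ, (((p : ℝ≥0∞) ^ k) ^ (u + 1))⁻¹
  have h1 : totalWeight p u = κ * totalWeight p (u + 1) := by
    have h := tsum_weight_succ_quot hp u fun _ => 1
    simp_rw [tsum_carrier_const, mul_one, card_mul_weight_succ, one_mul] at h
    exact h
  have h2 : κ * ∑' A : IsoClass p, f A * weight p (u + 1) A ≤
      ∑' A : IsoClass p, f A * weight p u A := by
    rw [← tsum_weight_succ_quot hp u f]
    refine ENNReal.tsum_le_tsum fun A => ?_
    calc _ ≤ (∑' _ : A.out.carrier, f A) * weight p (u + 1) A := by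
          gcongr with x
          exact hf A x
      _ = _ := by
          rw [tsum_carrier_const, ← card_mul_weight_succ u A]
          ring
  calc _ = (κ * ∑' A : IsoClass p, f A * weight p (u + 1) A) * totalWeight p (u + 1) := by
        rw [h1]; ring
    _ ≤ _ := by gcongr

theorem logCost_quot_le {p : ℕ} (hp : p.Prime) (u : ℕ) (A : IsoClass p) (x : A.out.carrier) :
    logCost u (IsoClass.mk (A.out.quot x)) ≤ logCost u A := by
  have h1 := one_le_groupCard (IsoClass.mk (A.out.quot x))
  have h2 := one_le_autCard (IsoClass.mk (A.out.quot x))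
  have h3 : (groupCard (IsoClass.mk (A.out.quot x)) : ℝ) ≤ groupCard A := by
    rw [groupCard_eq_mul_quot A x]
    exact_mod_cast Nat.le_mul_of_pos_left _ (addOrderOf_pos x)
  have h4 : (autCard (IsoClass.mk (A.out.quot x)) : ℝ) ≤ autCard A := by
    exact_mod_cast natCard_addAut_quot_le hp A x
  unfold logCost
  gcongr

theorem mean_logCost_succ_le {p : ℕ} (hp : p.Prime) (u : ℕ) :
    (∑' A : IsoClass p, realWeight (u + 1) A * logCost u A) / realTotalWeight p (u + 1) ≤
      (∑' A : IsoClass p, realWeight u A * logCost u A) / realTotalWeight p u := by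
  have hE : ∀ v : ℕ, ∑' A : IsoClass p, ENNReal.ofReal (logCost u A) * weight p v A =
      ENNReal.ofReal (∑' A : IsoClass p, realWeight v A * logCost u A) := by
    intro v
    rw [ENNReal.ofReal_tsum_of_nonneg
      (fun A => mul_nonneg (realWeight_pos v A).le (logCost_nonneg u A))
      (summable_realWeight_mul_logCost hp v u)]
    refine tsum_congr fun A => ?_
    rw [weight_eq_ofReal, ENNReal.ofReal_mul (realWeight_pos v A).le, mul_comm]
  have h := tsum_mul_weight_succ_mul_le hp u (fun A => ENNReal.ofReal (logCost u A))
    fun A x => ENNReal.ofReal_le_ofReal (logCost_quot_le hp u A x)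
  have h0 : ∀ v : ℕ, 0 ≤ ∑' A : IsoClass p, realWeight v A * logCost u A := fun v =>
    tsum_nonneg fun A => mul_nonneg (realWeight_pos v A).le (logCost_nonneg u A)
  have hZ := realTotalWeight_pos hp u
  have hZ' := realTotalWeight_pos hp (u + 1)
  rw [hE, hE, totalWeight_eq hp, totalWeight_eq hp, ← ENNReal.ofReal_mul (h0 _),
    ← ENNReal.ofReal_mul (h0 _), ENNReal.ofReal_le_ofReal_iff (mul_nonneg (h0 _) hZ'.le)] at h
  rwa [div_le_div_iff₀ hZ' hZ]

theorem exists_one_lt_groupCard {p : ℕ} (hp : p.Prime) : ∃ A : IsoClass p, 1 < groupCard A := by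
  have : NeZero p := ⟨hp.ne_zero⟩
  refine ⟨IsoClass.mk ⟨ZMod p, IsPGroup.of_card (n := 1) ?_⟩, ?_⟩
  · rw [pow_one]
    exact Nat.card_zmod p
  · rw [groupCard_mk]
    simpa using hp.one_lt

theorem realTotalWeight_succ_lt {p : ℕ} (hp : p.Prime) (u : ℕ) :
    realTotalWeight p (u + 1) < realTotalWeight p u := by
  obtain ⟨A, hA⟩ := exists_one_lt_groupCard hp
  refine Summable.tsum_lt_tsum (i := A) (fun B => ?_) ?_ (summable_realWeight hp _)
    (summable_realWeight hp _)
  · rw [realWeight_eq_mul_succ u B]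
    exact le_mul_of_one_le_right (realWeight_pos _ _).le (one_le_groupCard B)
  · rw [realWeight_eq_mul_succ u A]
    exact lt_mul_of_one_lt_right (realWeight_pos _ _) (by exact_mod_cast hA)

/-- Jensen's inequality for the logarithm of the order of a random group: for the unit rank `u + 1`
the mean of `#A` is `Z_u / Z_{u+1}`. -/
theorem mean_log_groupCard_lt {p : ℕ} (hp : p.Prime) (u : ℕ) :
    (∑' A : IsoClass p, realWeight (u + 1) A * Real.log (groupCard A)) / realTotalWeight p (u + 1)
      < Real.log (realTotalWeight p u) - Real.log (realTotalWeight p (u + 1)) := by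
  have hZ := realTotalWeight_pos hp u
  have hZ' := realTotalWeight_pos hp (u + 1)
  rw [← Real.log_div hZ.ne' hZ'.ne', div_lt_iff₀ hZ']
  -- The mean of the order of `A` for the unit rank `u + 1` is `r`.
  set r := realTotalWeight p u / realTotalWeight p (u + 1) with hr
  have hr1 : 1 < r := (one_lt_div hZ').2 (realTotalWeight_succ_lt hp u)
  have hr0 : 0 < r := by linarith
  have hlog : ∀ A : IsoClass p,
      Real.log (groupCard A) = Real.log (groupCard A / r) + Real.log r := fun A => by
    have := one_le_groupCard A
    rw [Real.log_div (by positivity) hr0.ne', sub_add_cancel]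
  have hs : Summable fun A : IsoClass p =>
      realWeight u A / r + realWeight (u + 1) A * (Real.log r - 1) :=
    ((summable_realWeight hp u).div_const r).add ((summable_realWeight hp (u + 1)).mul_right _)
  have hsum : ∑' A : IsoClass p, (realWeight u A / r + realWeight (u + 1) A * (Real.log r - 1))
      = Real.log r * realTotalWeight p (u + 1) := by
    rw [((summable_realWeight hp u).div_const r).tsum_add
      ((summable_realWeight hp (u + 1)).mul_right _), tsum_div_const, tsum_mul_right,
      ← realTotalWeight, ← realTotalWeight, hr]
    field_simp
    ring
  rw [← hsum]
  have hterm : ∀ A : IsoClass p, realWeight u A / r + realWeight (u + 1) A * (Real.log r - 1)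
      = realWeight (u + 1) A * ((groupCard A / r - 1) + Real.log r) := fun A => by
    rw [realWeight_eq_mul_succ u A]
    ring
  refine Summable.tsum_lt_tsum (i := trivialClass p) (fun A => ?_) ?_
    (summable_realWeight_mul_log hp _) hs
  · have := one_le_groupCard A
    rw [hterm, hlog]
    refine mul_le_mul_of_nonneg_left ?_ (realWeight_pos _ _).le
    gcongr
    exact Real.log_le_sub_one_of_pos (by positivity)
  · rw [hterm, hlog]
    refine mul_lt_mul_of_pos_left ?_ (realWeight_pos _ _)
    gcongr
    rw [groupCard_trivialClass, Nat.cast_one]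
    exact Real.log_lt_sub_one_of_pos (by positivity) (div_lt_one hr0 |>.2 hr1).ne

theorem realEntropy_succ_lt {p : ℕ} (hp : p.Prime) (u : ℕ) :
    realEntropy p (u + 1) < realEntropy p u := by
  have h1 := mean_logCost_succ_le hp u
  have h2 := mean_log_groupCard_lt hp u
  have h3 : ∑' A : IsoClass p, realWeight (u + 1) A * logCost (u + 1) A =
      ∑' A : IsoClass p, realWeight (u + 1) A * logCost u A +
        ∑' A : IsoClass p, realWeight (u + 1) A * Real.log (groupCard A) := by
    rw [← (summable_realWeight_mul_logCost hp _ u).tsum_add (summable_realWeight_mul_log hp _)]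
    simp_rw [logCost_succ, mul_add]
  rw [realEntropy, realEntropy, h3, add_div]
  linarith

/-! ### Decay of the entropy -/

theorem realWeight_le_of_groupCard_ne_one {p : ℕ} (hp : p.Prime) (u : ℕ) {A : IsoClass p}
    (hA : groupCard A ≠ 1) : realWeight u A ≤ ((p : ℝ)⁻¹) ^ u * (1 / autCard A) := by
  have h1 := one_le_groupCard A
  have h2 := one_le_autCard A
  have hpc : (p : ℝ) ≤ groupCard A := by
    have he : exponent A ≠ 0 := fun h => hA (by rw [groupCard_eq_pow hp A, h, pow_zero])
    rw [groupCard_eq_pow hp A]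
    exact_mod_cast Nat.le_self_pow he p
  have hp0 : (0 : ℝ) < p := by exact_mod_cast hp.pos
  rw [realWeight, mul_inv, inv_pow, one_div]
  gcongr

/-- The entropy decays at least like `u * p ^ (-u)`. -/
theorem realEntropy_le {p : ℕ} (hp : p.Prime) (u : ℕ) :
    realEntropy p u ≤ ((u : ℝ) * ((p : ℝ)⁻¹) ^ u + ((p : ℝ)⁻¹) ^ u) *
      ((logCostConst p + 1) *
        ∑' A : IsoClass p, ((exponent A : ℝ) + 1) ^ 2 / autCard A) := by
  classical
  have hp0 : (0 : ℝ) < p := by exact_mod_cast hp.pos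
  have hK := logCostConst_nonneg p
  set S := ∑' A : IsoClass p, ((exponent A : ℝ) + 1) ^ 2 / autCard A with hS
  have hs := summable_sq_exponent_div hp
  have hS0 : 0 ≤ S := tsum_nonneg fun A => by positivity
  have hZ1 := one_le_realTotalWeight hp u
  have hZ0 := realTotalWeight_pos hp u
  set q := ((p : ℝ)⁻¹) ^ u
  have hq : 0 ≤ q := by positivity
  -- Only the trivial group has a weight that does not decay, and it contributes `1` to `Z`.
  have hZ : realTotalWeight p u ≤ 1 + q * S := by
    have hsi : HasSum (fun A : IsoClass p => if A = trivialClass p then (1 : ℝ) else 0) 1 :=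
      hasSum_ite_eq (trivialClass p) 1
    have hsum := hsi.summable.tsum_add (hs.mul_left q)
    rw [hsi.tsum_eq, tsum_mul_left, ← hS] at hsum
    rw [← hsum]
    refine (summable_realWeight hp u).tsum_le_tsum (fun A => ?_)
      (hsi.summable.add (hs.mul_left q))
    split_ifs with hA
    · rw [hA, realWeight_trivialClass]
      have : 0 ≤ q * (((exponent (trivialClass p) : ℝ) + 1) ^ 2 / autCard (trivialClass p)) := by
        positivity
      linarith
    · rw [zero_add]
      refine (realWeight_le_of_groupCard_ne_one hp u fun h => hA (eq_trivialClass h)).trans ?_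
      have hn : (0 : ℝ) ≤ exponent A := Nat.cast_nonneg _
      gcongr
      nlinarith
  have hC : ∑' A : IsoClass p, realWeight u A * logCost u A ≤ (u + 1) * logCostConst p * q * S := by
    rw [hS, ← tsum_mul_left]
    refine (summable_realWeight_mul_logCost hp u u).tsum_le_tsum (fun A => ?_) (hs.mul_left _)
    by_cases hA : groupCard A = 1
    · have : logCost u A = 0 := by simp [logCost, hA, autCard_eq_one hA]
      rw [this, mul_zero]
      positivity
    · have h2 := one_le_autCard A
      calc _ ≤ q * (1 / (autCard A : ℝ)) * ((u + 1) * logCostConst p * (exponent A + 1) ^ 2) :=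
            mul_le_mul (realWeight_le_of_groupCard_ne_one hp u hA) (logCost_le hp u A)
              (logCost_nonneg u A) (by positivity)
        _ = _ := by ring
  have hE0 : 0 ≤ ∑' A : IsoClass p, realWeight u A * logCost u A :=
    tsum_nonneg fun A => mul_nonneg (realWeight_pos u A).le (logCost_nonneg u A)
  have h1 := Real.log_le_sub_one_of_pos hZ0
  have h2 := div_le_self hE0 hZ1
  have h3 : 0 ≤ (u : ℝ) * q * S := by positivity
  rw [realEntropy]
  calc _ ≤ q * S + (u + 1) * logCostConst p * q * S := by linarith
    _ ≤ q * S + (u + 1) * logCostConst p * q * S + u * q * S := by linarith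
    _ = _ := by ring

theorem tendsto_realEntropy {p : ℕ} (hp : p.Prime) : Tendsto (realEntropy p) atTop (𝓝 0) := by
  have hr : |(p : ℝ)⁻¹| < 1 := by
    rw [abs_inv, Nat.abs_cast]
    exact inv_lt_one_of_one_lt₀ (by exact_mod_cast hp.one_lt)
  have h1 := tendsto_pow_const_mul_const_pow_of_abs_lt_one 1 hr
  have h0 := tendsto_pow_atTop_nhds_zero_of_abs_lt_one hr
  simp only [pow_one] at h1
  have h := (h1.add h0).mul_const ((logCostConst p + 1) *
        ∑' A : IsoClass p, ((exponent A : ℝ) + 1) ^ 2 / autCard A)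
  rw [add_zero, zero_mul] at h
  exact squeeze_zero (realEntropy_nonneg hp) (realEntropy_le hp) h

end CohenLenstra

end

theorem theorem1 (p : ℕ) (hp : p.Prime) :
    (∀ u : ℕ, IsProbabilityMeasure (CohenLenstra.cohenLenstra p u)) ∧
    (∀ u : ℕ, CohenLenstra.shannonEntropy (CohenLenstra.cohenLenstra p u) < ∞) ∧
    StrictAnti (fun u : ℕ => CohenLenstra.shannonEntropy (CohenLenstra.cohenLenstra p u)) ∧
    Tendsto (fun u : ℕ => CohenLenstra.shannonEntropy (CohenLenstra.cohenLenstra p u))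
      atTop (𝓝 0) ∧
    (∀ u : ℕ, u ≠ 0 →
      CohenLenstra.shannonEntropy (CohenLenstra.cohenLenstra p u) <
        CohenLenstra.shannonEntropy (CohenLenstra.cohenLenstra p 0)) := by
  have hE := CohenLenstra.shannonEntropy_cohenLenstra hp
  have hanti : StrictAnti
      (fun u : ℕ => CohenLenstra.shannonEntropy (CohenLenstra.cohenLenstra p u)) := by
    refine strictAnti_nat_of_succ_lt fun u => ?_
    rw [hE, hE]
    have h := CohenLenstra.realEntropy_succ_lt hp u
    exact (ENNReal.ofReal_lt_ofReal_iff
      ((CohenLenstra.realEntropy_nonneg hp (u + 1)).trans_lt h)).2 h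
  refine ⟨CohenLenstra.isProbabilityMeasure_cohenLenstra hp, fun u => ?_, hanti, ?_,
    fun u hu => hanti (Nat.pos_of_ne_zero hu)⟩
  · rw [hE]
    exact ENNReal.ofReal_lt_top
  · simp_rw [hE]
    simpa using ENNReal.tendsto_ofReal (CohenLenstra.tendsto_realEntropy hp)
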